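/- **Setting.** Let $\Omega\subset\mathbb R^d$ ($d\ge1$) be a convex bounded polygonal domain. Let $\mu$ be a random vector, defined on a complete probability space, with values in a measurable set $\Gamma\subset\mathbb R^m$ and with joint probability density $\rho$. Put $\mathscr H^1(\Omega)=H^1(\Omega)\otimes L^2_\rho(\Gamma)=L^2(\Gamma,\rho\,d\mu;H^1(\Omega))$ and $\mathscr L^2(\Omega)=L^2(\Omega)\otimes L^2_\rho(\Gamma)$, with norms $\|v\|^2=\int_\Gamma\|v(\cdot,\mu)\|^2\rho\,d\mu$. Boundary values are traces in $L^2(\partial\Omega)$, prescribed for almost every $\mu$, and $\mathscr H^1_0(\Omega)=\{v\in\mathscr H^1(\Omega): v|_{\partial\Omega}=0\}$. Let $\mathscr U=\mathscr H^1(\Omega)\times\mathscr L^2(\Omega)$ with $\|(u,f)\|_{\mathscr U}=\|u\|_{\mathscr H^1(\Omega)}+\|f\|_{\mathscr L^2(\Omega)}$, and let $\mathscr U^0=\mathscr H^1_0(\Omega)\times\mathscr L^2(\Omega)$. For $\mu\in\Gamma$ let $a(\cdot,\cdot;\mu)$ be bilinear forms on $H^1(\Omega)$, measurable in $\mu$,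 and let $\tilde\alpha_0,\tilde\alpha_1>0$ be such that for all $\mu\in\Gamma$: $a(v,v;\mu)\ge\tilde\alpha_0\|v\|^2_{H^1(\Omega)}$ for all $v\in H^1_0(\Omega)$, and $a(u,v;\mu)\le\tilde\alpha_1\|u\|_{H^1(\Omega)}\|v\|_{H^1(\Omega)}$ for all $u,v\in H^1(\Omega)$. For random fields write $a(u,v)=\int_\Gamma a(u(\cdot,\mu),v(\cdot,\mu);\mu)\,\rho\,d\mu$, and $(\cdot,\cdot)$ for the inner product of $\mathscr L^2(\Omega)$. Let $\beta>0$, $\hat u\in\mathscr L^2(\Omega)$, $g\in L^2(\partial\Omega)$, and for $\underline u=(u,f)$, $\underline v=(v,h)$ in $\mathscr U$ and $q\in\mathscr H^1(\Omega)$ put $$\mathcal A(\underline u,\underline v)=(u,v)+2\beta(f,h),\qquad \mathcal B(\underline u,q)=a(u,q)-(f,q),$$ $$J(u,f)=\tfrac12\|u-\hat u\|^2_{\mathscr L^2(\Omega)}+\beta\|f\|^2_{\mathscr L^2(\Omega)},\qquad \mathcal J(\underline u)=\tfrac12\mathcal A(\underline u,\underline u)-(\hat u,u),$$ $$\mathscr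 U_0=\{\underline u\in\mathscr U:\ \mathcal B(\underline u,\tilde u)=0\ \ \forall\,\tilde u\in\mathscr H^1_0(\Omega)\}.$$ **Lemma.** 1. $\mathcal A$ is symmetric and nonnegative, and $|\mathcal A(\underline u,\underline v)|\le\max\{1,2\beta\}\|\underline u\|_{\mathscr U}\|\underline v\|_{\mathscr U}$ on $\mathscr U$. On the elements of the kernel $\mathscr U_0$ whose state vanishes on $\partial\Omega$ it is coercive: $\mathcal A(\underline u,\underline u)\ge2\beta\big(\tfrac{\tilde\alpha_0}{1+\tilde\alpha_0}\big)^2\|\underline u\|^2_{\mathscr U}$ for all $\underline u\in\mathscr U_0\cap\mathscr U^0$. 2. The integral defining $a(u,v)$ converges absolutely for all $u,v\in\mathscr H^1(\Omega)$. For all $\underline u\in\mathscr U$ and $q\in\mathscr H^1(\Omega)$, $|\mathcal B(\underline u,q)|\le\max\{\tilde\alpha_1,1\}\|\underline u\|_{\mathscr U}\|q\|_{\mathscr H^1(\Omega)}$. The inf-sup condition holds: $\sup_{0\ne\underline u\in\mathscr U}\mathcal B(\underline u,q)/\|\underline u\|_{\mathscr U}\ge\tilde\alpha_0\|q\|_{\mathscr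 H^1(\Omega)}$ for all $q\in\mathscr H^1_0(\Omega)$. 3. Let $(\mathscr U_{ad},\mathscr V)$ be either $(\mathscr U,\mathscr U)$ (no boundary condition) or $\big(\{(u,f)\in\mathscr U:u|_{\partial\Omega}=g\},\ \mathscr U^0\big)$ (Dirichlet condition). Then $\underline u\in\mathscr U$ solves $$\min_{\underline u\in\mathscr U_{ad}}\mathcal J(\underline u)\quad\text{s.t. }\ \mathcal B(\underline u,\tilde u)=0\ \ \forall\,\tilde u\in\mathscr H^1_0(\Omega)$$ if and only if $\underline u\in\mathscr U_{ad}$ and there is a unique $\lambda\in\mathscr H^1_0(\Omega)$ such that $(\underline u,\lambda)$ solves the saddle-point problem $$\mathcal A(\underline u,\underline v)+\mathcal B(\underline v,\lambda)=(\hat u,v)\ \ \forall\,\underline v=(v,h)\in\mathscr V,\qquad \mathcal B(\underline u,\tilde u)=0\ \ \forall\,\tilde u\in\mathscr H^1_0(\Omega).$$ 4. A pair $(u,f)\in\mathscr U$ solves the original problem of minimizing $J(u,f)$ over $\mathscr U$ subject to $a(u,v)=(f,v)$ for all $v\in\mathscr H^1_0(\Omega)$ and $u|_{\partial\Omega}=g$,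 if and only if $u|_{\partial\Omega}=g$ and there is a unique $\lambda\in\mathscr H^1_0(\Omega)$ such that the optimality system holds: $$a(u,\tilde u)=(f,\tilde u)\ \ \forall\,\tilde u\in\mathscr H^1_0(\Omega),\qquad a(\tilde\lambda,\lambda)=-(u-\hat u,\tilde\lambda)\ \ \forall\,\tilde\lambda\in\mathscr H^1_0(\Omega),\qquad 2\beta(f,\tilde f)=(\tilde f,\lambda)\ \ \forall\,\tilde f\in\mathscr L^2(\Omega).$$ -/

import Mathlib

open MeasureTheory
open scoped ENNReal ContDiff

noncomputable section

namespace StochOC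

/-- The Euclidean space `ℝᵈ`. -/
abbrev E (d : ℕ) : Type := EuclideanSpace ℝ (Fin d)

/-- `Ω` is a convex bounded polygonal (polytopal) domain of `ℝᵈ`: a nonempty open set that is the
interior of the convex hull of finitely many points. Such a set has a Lipschitz boundary. -/
def IsConvexPolygonalDomain {d : ℕ} (Ω : Set (E d)) : Prop :=
  Ω.Nonempty ∧ ∃ S : Finset (E d), Ω = interior (convexHull ℝ (S : Set (E d)))

/-! ### Function spaces on the physical domain -/

/-- `L²(Ω)`. -/
abbrev L2 {d : ℕ} (Ω : Set (E d)) : Type := Lp ℝ 2 (volume.restrict Ω)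

/-- `L²(Ω; ℝᵈ)`. -/
abbrev L2vec {d : ℕ} (Ω : Set (E d)) : Type := Lp (E d) 2 (volume.restrict Ω)

/-- `w` is the weak gradient of `u` on `Ω`:
`∫_Ω u ∇φ = - ∫_Ω φ w` for all `φ ∈ C_c^∞(Ω)`. -/
def IsWeakGradient {d : ℕ} (Ω : Set (E d)) (u : L2 Ω) (w : L2vec Ω) : Prop :=
  ∀ φ : E d → ℝ, ContDiff ℝ ∞ φ → HasCompactSupport φ → tsupport φ ⊆ Ω →
    ∫ x in Ω, u x • gradient φ x = - ∫ x in Ω, φ x • w x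

theorem memLp_gradient {d : ℕ} (Ω : Set (E d)) {φ : E d → ℝ} (h : ContDiff ℝ ∞ φ)
    (hc : HasCompactSupport φ) : MemLp (gradient φ) 2 (volume.restrict Ω) := by
  have h1 : Continuous (gradient φ) :=
    (InnerProductSpace.toDual ℝ (E d)).symm.continuous.comp (h.continuous_fderiv (by simp))
  have h2 : HasCompactSupport (gradient φ) :=
    (hc.fderiv (𝕜 := ℝ)).comp_left (g := (InnerProductSpace.toDual ℝ (E d)).symm) (map_zero _)
  exact (h1.memLp_of_hasCompactSupport h2).restrict Ω

theorem integrable_smul_gradient {d : ℕ} (Ω : Set (E d)) (u : L2 Ω) {φ : E d → ℝ}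
    (h : ContDiff ℝ ∞ φ) (hc : HasCompactSupport φ) :
    Integrable (fun x => u x • gradient φ x) (volume.restrict Ω) :=
  memLp_one_iff_integrable.1 ((memLp_gradient Ω h hc).smul (Lp.memLp u))

theorem integrable_smul_weak {d : ℕ} (Ω : Set (E d)) (w : L2vec Ω) {φ : E d → ℝ}
    (h : ContDiff ℝ ∞ φ) (hc : HasCompactSupport φ) :
    Integrable (fun x => φ x • w x) (volume.restrict Ω) :=
  memLp_one_iff_integrable.1
    ((Lp.memLp w).smul ((h.continuous.memLp_of_hasCompactSupport (p := 2) hc).restrict Ω))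

/-- The Sobolev space `H¹(Ω)`: pairs `(u, w)` with `u ∈ L²(Ω)` and `w = ∇u ∈ L²(Ω; ℝᵈ)` its weak
gradient, with the norm `(‖u‖² + ‖∇u‖²)^{1/2}`. -/
def H1 {d : ℕ} (Ω : Set (E d)) : Submodule ℝ (WithLp 2 (L2 Ω × L2vec Ω)) where
  carrier := {p | IsWeakGradient Ω p.fst p.snd}
  zero_mem' := by
    intro φ _ _ _
    have h1 : (fun x => (0 : L2 Ω) x • gradient φ x) =ᵐ[volume.restrict Ω] fun _ => 0 := by
      filter_upwards [Lp.coeFn_zero ℝ 2 (volume.restrict Ω)] with x hx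
      rw [hx, Pi.zero_apply, zero_smul]
    have h2 : (fun x => φ x • (0 : L2vec Ω) x) =ᵐ[volume.restrict Ω] fun _ => 0 := by
      filter_upwards [Lp.coeFn_zero (E d) 2 (volume.restrict Ω)] with x hx
      rw [hx, Pi.zero_apply, smul_zero]
    have e1 := integral_congr_ae h1
    have e2 := integral_congr_ae h2
    simp only [integral_zero] at e1 e2
    change ∫ x in Ω, (0 : L2 Ω) x • gradient φ x = - ∫ x in Ω, φ x • (0 : L2vec Ω) x
    rw [e1, e2, neg_zero]
  add_mem' := by
    intro p q hp hq φ h hc hs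
    have h1 : (fun x => (p.fst + q.fst) x • gradient φ x) =ᵐ[volume.restrict Ω]
        fun x => p.fst x • gradient φ x + q.fst x • gradient φ x := by
      filter_upwards [Lp.coeFn_add p.fst q.fst] with x hx
      rw [hx, Pi.add_apply, add_smul]
    have h2 : (fun x => φ x • (p.snd + q.snd) x) =ᵐ[volume.restrict Ω]
        fun x => φ x • p.snd x + φ x • q.snd x := by
      filter_upwards [Lp.coeFn_add p.snd q.snd] with x hx
      rw [hx, Pi.add_apply, smul_add]
    change ∫ x in Ω, (p.fst + q.fst) x • gradient φ x = - ∫ x in Ω, φ x • (p.snd + q.snd) x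
    rw [integral_congr_ae h1, integral_congr_ae h2,
      integral_add (integrable_smul_gradient Ω _ h hc) (integrable_smul_gradient Ω _ h hc),
      integral_add (integrable_smul_weak Ω _ h hc) (integrable_smul_weak Ω _ h hc),
      hp φ h hc hs, hq φ h hc hs, neg_add]
  smul_mem' := by
    intro c p hp φ h hc hs
    have h1 : (fun x => (c • p.fst) x • gradient φ x) =ᵐ[volume.restrict Ω]
        fun x => c • (p.fst x • gradient φ x) := by
      filter_upwards [Lp.coeFn_smul c p.fst] with x hx
      simp [hx, mul_smul]
    have h2 : (fun x => φ x • (c • p.snd) x) =ᵐ[volume.restrict Ω]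
        fun x => c • (φ x • p.snd x) := by
      filter_upwards [Lp.coeFn_smul c p.snd] with x hx
      simp only [hx, Pi.smul_apply]
      rw [smul_comm]
    change ∫ x in Ω, (c • p.fst) x • gradient φ x = - ∫ x in Ω, φ x • (c • p.snd) x
    rw [integral_congr_ae h1, integral_congr_ae h2, integral_smul, integral_smul,
      hp φ h hc hs, smul_neg]

/-- The inclusion `H¹(Ω) → L²(Ω)`. -/
def H1.toL2 {d : ℕ} (Ω : Set (E d)) : H1 Ω →L[ℝ] L2 Ω :=
  (WithLp.fstL 2 ℝ (L2 Ω) (L2vec Ω)).comp (H1 Ω).subtypeL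

/-- Surface measure on `∂Ω`. -/
def surfaceMeasure {d : ℕ} (Ω : Set (E d)) : Measure (E d) :=
  (μH[(d : ℝ) - 1]).restrict (frontier Ω)

/-- `L²(∂Ω)`. -/
abbrev L2Bdry {d : ℕ} (Ω : Set (E d)) : Type := Lp ℝ 2 (surfaceMeasure Ω)

/-- The pairs `(φ|_Ω, φ|_{∂Ω}) ∈ H¹(Ω) × L²(∂Ω)` with `φ` smooth on `ℝᵈ`. -/
def smoothTraceGraph {d : ℕ} (Ω : Set (E d)) : Submodule ℝ (H1 Ω × L2Bdry Ω) where
  carrier := {p | ∃ φ : E d → ℝ, ContDiff ℝ ∞ φ ∧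
    H1.toL2 Ω p.1 =ᵐ[volume.restrict Ω] φ ∧ p.2 =ᵐ[surfaceMeasure Ω] φ}
  zero_mem' := by
    refine ⟨fun _ => 0, contDiff_const, ?_, ?_⟩
    · rw [Prod.fst_zero, map_zero]
      exact Lp.coeFn_zero ℝ 2 (volume.restrict Ω)
    · exact Lp.coeFn_zero ℝ 2 (surfaceMeasure Ω)
  add_mem' := by
    rintro p q ⟨φ, hφ, h1, h2⟩ ⟨ψ, hψ, h3, h4⟩
    refine ⟨φ + ψ, hφ.add hψ, ?_, ?_⟩
    · rw [Prod.fst_add, map_add]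
      exact (Lp.coeFn_add _ _).trans (h1.add h3)
    · exact (Lp.coeFn_add _ _).trans (h2.add h4)
  smul_mem' := by
    rintro c p ⟨φ, hφ, h1, h2⟩
    refine ⟨c • φ, contDiff_const.smul hφ, ?_, ?_⟩
    · rw [Prod.smul_fst, map_smul]
      exact (Lp.coeFn_smul _ _).trans (h1.const_smul c)
    · exact (Lp.coeFn_smul _ _).trans (h2.const_smul c)

/-- The graph of the trace operator `H¹(Ω) → L²(∂Ω)`: the closure of the graph of the restriction
`φ|_Ω ↦ φ|_{∂Ω}` on smooth functions. -/
def traceGraph {d : ℕ} (Ω : Set (E d)) : Submodule ℝ (H1 Ω × L2Bdry Ω) :=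
  (smoothTraceGraph Ω).topologicalClosure

/-- `u|_{∂Ω} = g` in the sense of traces. -/
def HasTrace {d : ℕ} (Ω : Set (E d)) (u : H1 Ω) (g : L2Bdry Ω) : Prop :=
  (u, g) ∈ traceGraph Ω

/-- `H¹₀(Ω) = {u ∈ H¹(Ω) : u|_{∂Ω} = 0}`. -/
def H10 {d : ℕ} (Ω : Set (E d)) : Submodule ℝ (H1 Ω) :=
  (traceGraph Ω).comap (LinearMap.inl ℝ (H1 Ω) (L2Bdry Ω))

theorem mem_H10 {d : ℕ} (Ω : Set (E d)) (u : H1 Ω) : u ∈ H10 Ω ↔ HasTrace Ω u 0 := Iff.rfl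

/-! ### Function spaces of random fields

`P` is a measure on the parameter space; it is `ρ dμ` on `Γ` in the theorem. -/

/-- The measure `ρ dμ` on `Γ`. -/
def paramMeasure {m : ℕ} (Γ : Set (E m)) (ρ : E m → ℝ≥0∞) : Measure (E m) :=
  (volume.restrict Γ).withDensity ρ

section Fields

variable {d m : ℕ} (Ω : Set (E d)) (P : Measure (E m))

/-- `𝓗¹(Ω) = H¹(Ω) ⊗ L²_ρ(Γ)`, i.e. `L²(Γ, ρ dμ; H¹(Ω))`, with norm
`(∫ ‖v(·,μ)‖²_{H¹(Ω)} ρ dμ)^{1/2}`. -/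
abbrev RH1 : Type := Lp (H1 Ω) 2 P

/-- `𝓛²(Ω) = L²(Ω) ⊗ L²_ρ(Γ)`, i.e. `L²(Γ, ρ dμ; L²(Ω))`. -/
abbrev RL2 : Type := Lp (L2 Ω) 2 P

/-- The inclusion `𝓗¹(Ω) → 𝓛²(Ω)`. -/
def RH1.toRL2 : RH1 Ω P →L[ℝ] RL2 Ω P :=
  (H1.toL2 Ω).compLpL 2 P

/-- `𝓗¹₀(Ω)`: random fields with `v(·,μ)|_{∂Ω} = 0` almost surely. -/
def RH10 : Submodule ℝ (RH1 Ω P) where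
  carrier := {v | ∀ᵐ y ∂P, v y ∈ H10 Ω}
  zero_mem' := by
    filter_upwards [Lp.coeFn_zero (H1 Ω) 2 P] with y hy
    rw [hy]
    exact (H10 Ω).zero_mem
  add_mem' := by
    intro u v hu hv
    change ∀ᵐ y ∂P, (u + v) y ∈ H10 Ω
    filter_upwards [Lp.coeFn_add u v, hu, hv] with y hy h1 h2
    rw [hy]
    exact (H10 Ω).add_mem h1 h2
  smul_mem' := by
    intro c u hu
    change ∀ᵐ y ∂P, (c • u) y ∈ H10 Ω
    filter_upwards [Lp.coeFn_smul c u, hu] with y hy h1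
    rw [hy]
    exact (H10 Ω).smul_mem c h1

/-- `𝓤 = 𝓗¹(Ω) × 𝓛²(Ω)`, the space of pairs (state, control). -/
abbrev UU : Type := RH1 Ω P × RL2 Ω P

variable {Ω P}

/-- The graph norm `‖u‖_{𝓗¹} + ‖f‖_{𝓛²}` of `(u, f) ∈ 𝓤`. -/
def graphNorm (U : UU Ω P) : ℝ := ‖U.1‖ + ‖U.2‖

/-- The Dirichlet condition `u|_{∂Ω} = g` on the state, almost surely. -/
def dirichletSet (g : L2Bdry Ω) : Set (UU Ω P) :=
  {U | ∀ᵐ y ∂P, HasTrace Ω (U.1 y) g}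

variable (Ω P) in
/-- `𝓗¹₀(Ω) × 𝓛²(Ω)`, the pairs whose state vanishes on `∂Ω`. -/
def UU0 : Submodule ℝ (UU Ω P) := (RH10 Ω P).prod ⊤

/-! ### Forms and functionals -/

/-- A family `a(·,·;μ)` of bilinear forms on `H¹(Ω)`. -/
abbrev FormFamily (m : ℕ) {d : ℕ} (Ω : Set (E d)) : Type := E m → H1 Ω →ₗ[ℝ] H1 Ω →ₗ[ℝ] ℝ

/-- The form `a` on random fields: `∫ a(u(·,μ), v(·,μ); μ) ρ dμ`. -/
def aForm (a : FormFamily m Ω) (u v : RH1 Ω P) : ℝ :=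
  ∫ y, a y (u y) (v y) ∂P

/-- `𝓐((u,f),(v,h)) = (u,v) + 2β(f,h)`. -/
def AForm (β : ℝ) (U V : UU Ω P) : ℝ :=
  inner ℝ (RH1.toRL2 Ω P U.1) (RH1.toRL2 Ω P V.1) + 2 * β * inner ℝ U.2 V.2

/-- `𝓑((u,f),q) = a(u,q) - (f,q)`. -/
def BForm (a : FormFamily m Ω) (U : UU Ω P) (q : RH1 Ω P) : ℝ :=
  aForm a U.1 q - inner ℝ U.2 (RH1.toRL2 Ω P q)

/-- The kernel `𝓤₀` of `𝓑`. -/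
def kerB (a : FormFamily m Ω) : Set (UU Ω P) :=
  {U | ∀ q ∈ RH10 Ω P, BForm a U q = 0}

/-- The cost `J(u,f) = ½‖u - û‖² + β‖f‖²`, norms in `𝓛²(Ω)`. -/
def cost (β : ℝ) (uhat : RL2 Ω P) (U : UU Ω P) : ℝ :=
  1 / 2 * ‖RH1.toRL2 Ω P U.1 - uhat‖ ^ 2 + β * ‖U.2‖ ^ 2

/-- The quadratic functional `½ 𝓐(U,U) - (û,u)` for `U = (u,f)`. -/
def quadCost (β : ℝ) (uhat : RL2 Ω P) (U : UU Ω P) : ℝ :=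
  1 / 2 * AForm β U U - inner ℝ uhat (RH1.toRL2 Ω P U.1)

/-! ### The problems -/

/-- The original control problem: `(u,f)` minimizes `J` among all `(u,f) ∈ 𝓤` that satisfy
`u|_{∂Ω} = g` and `a(u,v) = (f,v)` for all `v ∈ 𝓗¹₀(Ω)`. -/
def IsOptimalControl (a : FormFamily m Ω) (β : ℝ) (uhat : RL2 Ω P) (g : L2Bdry Ω)
    (U : UU Ω P) : Prop :=
  let feasible : Set (UU Ω P) := {W | W ∈ dirichletSet g ∧
    ∀ v ∈ RH10 Ω P, aForm a W.1 v = inner ℝ W.2 (RH1.toRL2 Ω P v)}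
  U ∈ feasible ∧ ∀ W ∈ feasible, cost β uhat U ≤ cost β uhat W

/-- The constrained quadratic minimization over the admissible set `Uad`:
`U` minimizes `½ 𝓐(U,U) - (û,u)` over all `U ∈ Uad` with `𝓑(U,q) = 0` for all `q ∈ 𝓗¹₀(Ω)`. -/
def IsQuadMinimizer (Uad : Set (UU Ω P)) (a : FormFamily m Ω) (β : ℝ) (uhat : RL2 Ω P)
    (U : UU Ω P) : Prop :=
  let feasible : Set (UU Ω P) := {W | W ∈ Uad ∧ ∀ q ∈ RH10 Ω P, BForm a W q = 0}
  U ∈ feasible ∧ ∀ W ∈ feasible, quadCost β uhat U ≤ quadCost β uhat W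

/-- The saddle-point problem with admissible set `Uad` and space `V` of test pairs: `U ∈ Uad`,
`lam ∈ 𝓗¹₀(Ω)`, `𝓐(U,V) + 𝓑(V,lam) = (û,v)` for all `V = (v,h)` in the test space, and
`𝓑(U,q) = 0` for all `q ∈ 𝓗¹₀(Ω)`. -/
def IsSaddlePoint (Uad : Set (UU Ω P)) (V : Submodule ℝ (UU Ω P)) (a : FormFamily m Ω) (β : ℝ)
    (uhat : RL2 Ω P) (U : UU Ω P) (lam : RH1 Ω P) : Prop :=
  U ∈ Uad ∧ lam ∈ RH10 Ω P ∧
  (∀ W ∈ V, AForm β U W + BForm a W lam = inner ℝ uhat (RH1.toRL2 Ω P W.1)) ∧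
  (∀ q ∈ RH10 Ω P, BForm a U q = 0)

/-- The optimality system: boundary condition, state, adjoint and gradient equation. -/
def IsOptimalitySystemSol (a : FormFamily m Ω) (β : ℝ) (uhat : RL2 Ω P) (g : L2Bdry Ω)
    (U : UU Ω P) (lam : RH1 Ω P) : Prop :=
  U ∈ dirichletSet g ∧ lam ∈ RH10 Ω P ∧
  (∀ v ∈ RH10 Ω P, aForm a U.1 v = inner ℝ U.2 (RH1.toRL2 Ω P v)) ∧
  (∀ v ∈ RH10 Ω P,
    aForm a v lam = - inner ℝ (RH1.toRL2 Ω P U.1 - uhat) (RH1.toRL2 Ω P v)) ∧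
  (∀ h : RL2 Ω P, 2 * β * inner ℝ U.2 h = inner ℝ h (RH1.toRL2 Ω P lam))

end Fields

end StochOC

end

namespace StochOC

/-! ### Instance shortcuts -/

-- This is Brezzi's theory for a quadratic functional under a linear constraint, where both the
-- kernel coercivity of `𝓐` and the inf-sup condition for `𝓑` come from coercivity of `a`.
-- Integrating the pointwise bounds over the parameter makes `a` a bounded bilinear form on `𝓗¹(Ω)`,
-- coercive on the closed subspace `𝓗¹₀(Ω)`. A kernel element with vanishing state, tested with that
-- state, has its state dominated by its control, which `2β‖f‖²` measures; and the pair `(q, 0)`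
-- realizes the inf-sup bound.
--
-- For the equivalences, a feasible point is a minimizer exactly when the derivative of the cost
-- vanishes on admissible directions in the kernel of `𝓑` (`isQuadMinimizer_iff`). Lax–Milgram then
-- acts twice (`isQuadMinimizer_iff_existsUnique`). The adjoint equation produces the multiplier on
-- directions `(w, 0)`. The state equation splits any direction into such a pair and a kernel
-- element. Coercivity makes the multiplier unique. The optimality system is the saddle-point system
-- tested separately with states and controls.
--
-- Only equivalences are proved, so `g` needs no extension into `Ω`: without one, both sides are
-- false. Of traces, only the fact that their graph is a closed subspace is used.

noncomputable scoped instance {d : ℕ} (Ω : Set (E d)) :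
    NormedAddCommGroup (H1 Ω) := (H1 Ω).normedAddCommGroup

noncomputable scoped instance {d : ℕ} (Ω : Set (E d)) :
    InnerProductSpace ℝ (H1 Ω) := (H1 Ω).innerProductSpace

noncomputable scoped instance {d : ℕ} (Ω : Set (E d)) : NormedSpace ℝ (H1 Ω) := (H1 Ω).normedSpace

noncomputable scoped instance {d m : ℕ} (Ω : Set (E d)) (P : Measure (E m)) :
    NormedAddCommGroup (RH1 Ω P) :=
  Lp.instNormedAddCommGroup

noncomputable scoped instance {d m : ℕ} (Ω : Set (E d)) (P : Measure (E m)) :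
    NormedSpace ℝ (RH1 Ω P) :=
  Lp.instNormedSpace

noncomputable scoped instance {d m : ℕ} (Ω : Set (E d)) (P : Measure (E m)) :
    InnerProductSpace ℝ (RH1 Ω P) :=
  L2.innerProductSpace

/-! ### Parameter-dependent bilinear forms and Lax–Milgram -/

section Abstract

variable {α H : Type*} [MeasurableSpace α] [NormedAddCommGroup H] [NormedSpace ℝ H]

theorem abs_bilin_le {b : H →ₗ[ℝ] H →ₗ[ℝ] ℝ} {C : ℝ} (h : ∀ u v, b u v ≤ C * ‖u‖ * ‖v‖)
    (u v : H) : |b u v| ≤ C * ‖u‖ * ‖v‖ := by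
  refine abs_le.2 ⟨?_, h u v⟩
  have := h (-u) v
  rw [map_neg, LinearMap.neg_apply, norm_neg] at this
  linarith

theorem aemeasurable_bilin_simpleFunc {μ : Measure α} {a : α → H →ₗ[ℝ] H →ₗ[ℝ] ℝ}
    (ha : ∀ u v, AEMeasurable (fun y => a y u v) μ) (s t : SimpleFunc α H) :
    AEMeasurable (fun y => a y (s y) (t y)) μ := by
  classical
  have h : (fun y => a y (s y) (t y)) = fun y => ∑ x ∈ s.range, ∑ z ∈ t.range,
      (s ⁻¹' {x} ∩ t ⁻¹' {z}).indicator (fun y => a y x z) y := by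
    funext y
    rw [Finset.sum_eq_single (s y), Finset.sum_eq_single (t y)]
    · simp
    · intro z _ hz
      exact Set.indicator_of_notMem (fun h => hz h.2.symm) _
    · intro h
      exact absurd (t.mem_range_self y) h
    · intro x _ hx
      exact Finset.sum_eq_zero fun z _ =>
        Set.indicator_of_notMem (fun h => hx h.1.symm) _
    · intro h
      exact absurd (s.mem_range_self y) h
  rw [h]
  refine Finset.aemeasurable_fun_sum _ fun x _ => Finset.aemeasurable_fun_sum _ fun z _ => ?_
  exact (ha x z).indicator ((s.measurableSet_preimage _).inter (t.measurableSet_preimage _))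

/-- Measurability is assumed only for fixed arguments. It passes to varying ones by simple
approximation, since the bound makes almost every form jointly continuous. -/
theorem aemeasurable_bilin {μ : Measure α} {a : α → H →ₗ[ℝ] H →ₗ[ℝ] ℝ} {C : ℝ}
    (ha : ∀ u v, AEMeasurable (fun y => a y u v) μ)
    (hbd : ∀ᵐ y ∂μ, ∀ u v, a y u v ≤ C * ‖u‖ * ‖v‖) {u v : α → H}
    (hu : AEStronglyMeasurable u μ) (hv : AEStronglyMeasurable v μ) :
    AEMeasurable (fun y => a y (u y) (v y)) μ := by
  refine aemeasurable_of_tendsto_metrizable_ae Filter.atTop (fun n : ℕ =>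
    aemeasurable_bilin_simpleFunc ha (hu.stronglyMeasurable_mk.approx n)
      (hv.stronglyMeasurable_mk.approx n)) ?_
  filter_upwards [hbd, hu.ae_eq_mk, hv.ae_eq_mk] with y hy h1 h2
  rw [h1, h2]
  let b : H →L[ℝ] H →L[ℝ] ℝ := (a y).mkContinuous₂ C (abs_bilin_le hy)
  exact (b.continuous₂.tendsto (hu.mk u y, hv.mk v y)).comp
    ((hu.stronglyMeasurable_mk.tendsto_approx y).prodMk_nhds
      (hv.stronglyMeasurable_mk.tendsto_approx y))

-- Cauchy–Schwarz for the scalar functions `‖u ·‖` and `‖v ·‖`, whose `L²` norms are those of `u`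
-- and `v`.
omit [NormedSpace ℝ H] in
theorem integral_norm_mul_norm_le {μ : Measure α} (u v : Lp H 2 μ) :
    Integrable (fun y => ‖u y‖ * ‖v y‖) μ ∧ ∫ y, ‖u y‖ * ‖v y‖ ∂μ ≤ ‖u‖ * ‖v‖ := by
  let n (w : Lp H 2 μ) : Lp ℝ 2 μ := (Lp.memLp w).norm.toLp
  have hn (w : Lp H 2 μ) : ‖n w‖ = ‖w‖ := by
    rw [Lp.norm_toLp, eLpNorm_norm, Lp.norm_def]
  have he : (fun y => inner ℝ (n u y) (n v y)) =ᵐ[μ] fun y => ‖u y‖ * ‖v y‖ := by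
    filter_upwards [(Lp.memLp u).norm.coeFn_toLp, (Lp.memLp v).norm.coeFn_toLp] with y h1 h2
    simp only [n, h1, h2, RCLike.inner_apply, conj_trivial]
    ring
  refine ⟨(L2.integrable_inner (n u) (n v)).congr he, ?_⟩
  rw [← integral_congr_ae he, ← L2.inner_def, ← hn u, ← hn v]
  exact real_inner_le_norm _ _

theorem norm_compLpL_apply_le {μ : Measure α} {K : Type*} [NormedAddCommGroup K]
    [NormedSpace ℝ K] {L : H →L[ℝ] K} (hL : ∀ x, ‖L x‖ ≤ ‖x‖) (u : Lp H 2 μ) :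
    ‖L.compLpL 2 μ u‖ ≤ ‖u‖ := by
  refine Lp.norm_le_norm_of_ae_le ?_
  filter_upwards [L.coeFn_compLpL u] with y hy
  rw [hy]
  exact hL _

/-- The Lax–Milgram theorem for a bounded bilinear form that is coercive on a subspace. -/
theorem exists_mem_eq_of_coercive {V : Type*} [NormedAddCommGroup V] [InnerProductSpace ℝ V]
    {S : Submodule ℝ V} [CompleteSpace S] {B : V →L[ℝ] V →L[ℝ] ℝ} {c : ℝ} (hc : 0 < c)
    (hB : ∀ v ∈ S, c * ‖v‖ ^ 2 ≤ B v v) (l : V →L[ℝ] ℝ) : ∃ w ∈ S, ∀ q ∈ S, B w q = l q := by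
  let B₀ : S →L[ℝ] S →L[ℝ] ℝ := B.bilinearComp S.subtypeL S.subtypeL
  have h : IsCoercive B₀ := ⟨c, hc, fun v => by
    rw [mul_assoc, ← sq]
    exact hB v v.2⟩
  -- The Riesz representative of `l` on `S`; the solution is its preimage under the operator that
  -- represents `B₀`.
  let r : S := (InnerProductSpace.toDual ℝ S).symm (l.comp S.subtypeL)
  refine ⟨h.continuousLinearEquivOfBilin.symm r, Subtype.property _, fun q hq => ?_⟩
  have h1 := h.continuousLinearEquivOfBilin_apply (h.continuousLinearEquivOfBilin.symm r) ⟨q, hq⟩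
  rw [ContinuousLinearEquiv.apply_symm_apply, InnerProductSpace.toDual_symm_apply] at h1
  exact h1.symm

end Abstract

/-! ### Completeness of the function spaces -/

/-- For a fixed test function, both sides of the weak-gradient identity are `L²` pairings, hence
continuous in the pair. -/
theorem isClosed_H1 {d : ℕ} (Ω : Set (E d)) :
    IsClosed (H1 Ω : Set (WithLp 2 (L2 Ω × L2vec Ω))) := by
  have h : (H1 Ω : Set (WithLp 2 (L2 Ω × L2vec Ω))) = ⋂ (φ : E d → ℝ) (_ : ContDiff ℝ ∞ φ)
      (_ : HasCompactSupport φ) (_ : tsupport φ ⊆ Ω), {p | ∫ x in Ω, p.fst x • gradient φ x =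
        - ∫ x in Ω, φ x • p.snd x} := by
    ext p
    simp only [Set.mem_iInter]
    exact Iff.rfl
  rw [h]
  refine isClosed_iInter fun φ => isClosed_iInter fun hφ => isClosed_iInter fun hc =>
    isClosed_iInter fun _ => ?_
  have hm : MemLp φ 2 (volume.restrict Ω) :=
    (hφ.continuous.memLp_of_hasCompactSupport hc).restrict Ω
  let S : ℝ →L[ℝ] E d →L[ℝ] E d := ContinuousLinearMap.lsmul ℝ ℝ
  have h1 (p : WithLp 2 (L2 Ω × L2vec Ω)) : ∫ x in Ω, p.fst x • gradient φ x =
      S.lpPairing (volume.restrict Ω) 2 2 p.fst (memLp_gradient Ω hφ hc).toLp := by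
    rw [ContinuousLinearMap.lpPairing_eq_integral]
    refine integral_congr_ae ?_
    filter_upwards [(memLp_gradient Ω hφ hc).coeFn_toLp] with x hx
    rw [hx]
    rfl
  have h2 (p : WithLp 2 (L2 Ω × L2vec Ω)) : ∫ x in Ω, φ x • p.snd x =
      S.lpPairing (volume.restrict Ω) 2 2 hm.toLp p.snd := by
    rw [ContinuousLinearMap.lpPairing_eq_integral]
    refine integral_congr_ae ?_
    filter_upwards [hm.coeFn_toLp] with x hx
    rw [hx]
    rfl
  simp_rw [h1, h2]
  refine isClosed_eq ?_ ?_
  · exact (((S.lpPairing (volume.restrict Ω) 2 2).flip _).comp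
      (WithLp.fstL 2 ℝ (L2 Ω) (L2vec Ω))).continuous
  · exact ((S.lpPairing (volume.restrict Ω) 2 2 _).comp
      (WithLp.sndL 2 ℝ (L2 Ω) (L2vec Ω))).continuous.neg

instance {d : ℕ} (Ω : Set (E d)) : CompleteSpace (H1 Ω) :=
  (isClosed_H1 Ω).completeSpace_coe

theorem isClosed_H10 {d : ℕ} (Ω : Set (E d)) : IsClosed (H10 Ω : Set (H1 Ω)) :=
  (smoothTraceGraph Ω).isClosed_topologicalClosure.preimage
    (ContinuousLinearMap.inl ℝ (H1 Ω) (L2Bdry Ω)).continuous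

section Fields

variable {d m : ℕ} {Ω : Set (E d)} {P : Measure (E m)}

/-- A convergent sequence in `L²` has an almost everywhere convergent subsequence, and `H10 Ω` is
closed. -/
theorem isClosed_RH10 : IsClosed (RH10 Ω P : Set (RH1 Ω P)) := by
  refine IsSeqClosed.isClosed fun f v hf hv => ?_
  obtain ⟨φ, -, hφ⟩ := (tendstoInMeasure_of_tendsto_Lp hv).exists_seq_tendsto_ae
  have hmem : ∀ᵐ y ∂P, ∀ n, f n y ∈ H10 Ω := ae_all_iff.2 hf
  change ∀ᵐ y ∂P, v y ∈ H10 Ω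
  filter_upwards [hφ, hmem] with y h1 h2
  exact (isClosed_H10 Ω).mem_of_tendsto h1 (Filter.Eventually.of_forall fun n => h2 (φ n))

instance : CompleteSpace (RH10 Ω P) := isClosed_RH10.completeSpace_coe

theorem norm_toL2_le (u : H1 Ω) : ‖H1.toL2 Ω u‖ ≤ ‖u‖ :=
  WithLp.norm_fst_le (x := (u : WithLp 2 (L2 Ω × L2vec Ω)))

theorem norm_toRL2_le (u : RH1 Ω P) : ‖RH1.toRL2 Ω P u‖ ≤ ‖u‖ :=
  norm_compLpL_apply_le norm_toL2_le u

/-! ### The form `a` on random fields -/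

/-- The assumptions on `a(·,·;μ)`, for `P`-almost every parameter. -/
structure IsAdmissibleFamily (P : Measure (E m)) (a : FormFamily m Ω) (α₀ α₁ : ℝ) : Prop where
  aemeasurable : ∀ u v : H1 Ω, AEMeasurable (fun y => a y u v) P
  coercive : ∀ᵐ y ∂P, ∀ v ∈ H10 Ω, α₀ * ‖v‖ ^ 2 ≤ a y v v
  bounded : ∀ᵐ y ∂P, ∀ u v : H1 Ω, a y u v ≤ α₁ * ‖u‖ * ‖v‖
  coercive_pos : 0 < α₀
  bounded_pos : 0 < α₁

namespace IsAdmissibleFamily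

variable {a : FormFamily m Ω} {α₀ α₁ : ℝ} (ha : IsAdmissibleFamily P a α₀ α₁)
include ha

theorem integrable (u v : RH1 Ω P) : Integrable (fun y => a y (u y) (v y)) P := by
  refine ((integral_norm_mul_norm_le u v).1.const_mul α₁).mono'
    (aemeasurable_bilin ha.aemeasurable ha.bounded (Lp.aestronglyMeasurable u)
      (Lp.aestronglyMeasurable v)).aestronglyMeasurable ?_
  filter_upwards [ha.bounded] with y hy
  rw [← mul_assoc]
  exact abs_bilin_le hy _ _

theorem abs_aForm_le (u v : RH1 Ω P) : |aForm a u v| ≤ α₁ * ‖u‖ * ‖v‖ := by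
  have h := integral_norm_mul_norm_le u v
  calc |aForm a u v| ≤ ∫ y, α₁ * (‖u y‖ * ‖v y‖) ∂P := by
        rw [aForm, ← Real.norm_eq_abs]
        refine norm_integral_le_of_norm_le (h.1.const_mul α₁) ?_
        filter_upwards [ha.bounded] with y hy
        rw [← mul_assoc]
        exact abs_bilin_le hy _ _
    _ = α₁ * ∫ y, ‖u y‖ * ‖v y‖ ∂P := integral_const_mul _ _
    _ ≤ α₁ * (‖u‖ * ‖v‖) := mul_le_mul_of_nonneg_left h.2 ha.bounded_pos.le
    _ = α₁ * ‖u‖ * ‖v‖ := by ring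

theorem aForm_coercive {v : RH1 Ω P} (hv : v ∈ RH10 Ω P) : α₀ * ‖v‖ ^ 2 ≤ aForm a v v := by
  rw [← real_inner_self_eq_norm_sq, L2.inner_def, ← integral_const_mul]
  refine integral_mono_ae ((L2.integrable_inner v v).const_mul α₀) (ha.integrable v v) ?_
  have hv' : ∀ᵐ y ∂P, v y ∈ H10 Ω := hv
  filter_upwards [ha.coercive, hv'] with y h1 h2
  rw [real_inner_self_eq_norm_sq]
  exact h1 _ h2

theorem aForm_add_left (u v w : RH1 Ω P) : aForm a (u + v) w = aForm a u w + aForm a v w := by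
  rw [aForm, aForm, aForm, ← integral_add (ha.integrable u w) (ha.integrable v w)]
  refine integral_congr_ae ?_
  filter_upwards [Lp.coeFn_add u v] with y hy
  rw [hy, Pi.add_apply, map_add, LinearMap.add_apply]

theorem aForm_add_right (u v w : RH1 Ω P) : aForm a u (v + w) = aForm a u v + aForm a u w := by
  rw [aForm, aForm, aForm, ← integral_add (ha.integrable u v) (ha.integrable u w)]
  refine integral_congr_ae ?_
  filter_upwards [Lp.coeFn_add v w] with y hy
  rw [hy, Pi.add_apply, map_add]

omit ha in
theorem aForm_smul_left (c : ℝ) (u v : RH1 Ω P) : aForm a (c • u) v = c * aForm a u v := by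
  rw [aForm, aForm, ← integral_const_mul]
  refine integral_congr_ae ?_
  filter_upwards [Lp.coeFn_smul c u] with y hy
  rw [hy, Pi.smul_apply, map_smul, LinearMap.smul_apply, smul_eq_mul]

omit ha in
theorem aForm_smul_right (c : ℝ) (u v : RH1 Ω P) : aForm a u (c • v) = c * aForm a u v := by
  rw [aForm, aForm, ← integral_const_mul]
  refine integral_congr_ae ?_
  filter_upwards [Lp.coeFn_smul c v] with y hy
  rw [hy, Pi.smul_apply, map_smul, smul_eq_mul]

/-- The form `a` on random fields as a bounded bilinear form. -/
noncomputable def toBilin : RH1 Ω P →L[ℝ] RH1 Ω P →L[ℝ] ℝ :=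
  (LinearMap.mk₂ ℝ (aForm a) ha.aForm_add_left aForm_smul_left ha.aForm_add_right
    aForm_smul_right).mkContinuous₂ α₁ ha.abs_aForm_le

theorem toBilin_apply (u v : RH1 Ω P) : ha.toBilin u v = aForm a u v := rfl

theorem exists_aForm_eq (l : RH1 Ω P →L[ℝ] ℝ) :
    ∃ w ∈ RH10 Ω P, ∀ q ∈ RH10 Ω P, aForm a w q = l q :=
  exists_mem_eq_of_coercive (B := ha.toBilin) ha.coercive_pos (fun _ hv => ha.aForm_coercive hv) l

/-- Solvability of the adjoint equation. As `a` need not be symmetric, Lax–Milgram is applied to the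
flipped form, which has the same diagonal and so the same coercivity. -/
theorem exists_aForm_flip_eq (l : RH1 Ω P →L[ℝ] ℝ) :
    ∃ w ∈ RH10 Ω P, ∀ q ∈ RH10 Ω P, aForm a q w = l q :=
  exists_mem_eq_of_coercive (B := ha.toBilin.flip) ha.coercive_pos
    (fun _ hv => ha.aForm_coercive hv) l

theorem eq_of_aForm_eq {p q : RH1 Ω P} (hp : p ∈ RH10 Ω P) (hq : q ∈ RH10 Ω P)
    (h : ∀ w ∈ RH10 Ω P, aForm a w p = aForm a w q) : p = q := by
  have hpq := (RH10 Ω P).sub_mem hp hq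
  have h0 : aForm a (p - q) (p - q) = 0 := by
    rw [← ha.toBilin_apply, map_sub (ha.toBilin (p - q)), ha.toBilin_apply, ha.toBilin_apply,
      h _ hpq, sub_self]
  have h1 := ha.aForm_coercive hpq
  rw [h0] at h1
  have h2 : ‖p - q‖ ^ 2 = 0 :=
    le_antisymm (nonpos_of_mul_nonpos_right h1 ha.coercive_pos) (sq_nonneg _)
  exact sub_eq_zero.1 (norm_eq_zero.1 (pow_eq_zero_iff two_ne_zero |>.1 h2))

end IsAdmissibleFamily

/-! ### The forms `𝓐` and `𝓑` -/

theorem graphNorm_nonneg (U : UU Ω P) : 0 ≤ graphNorm U := by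
  unfold graphNorm
  positivity

theorem AForm_comm (β : ℝ) (U V : UU Ω P) : AForm β U V = AForm β V U := by
  rw [AForm, AForm, real_inner_comm, real_inner_comm V.2]

theorem AForm_self (β : ℝ) (U : UU Ω P) :
    AForm β U U = ‖RH1.toRL2 Ω P U.1‖ ^ 2 + 2 * β * ‖U.2‖ ^ 2 := by
  rw [AForm, real_inner_self_eq_norm_sq, real_inner_self_eq_norm_sq]

theorem AForm_self_nonneg {β : ℝ} (hβ : 0 < β) (U : UU Ω P) : 0 ≤ AForm β U U := by
  rw [AForm_self]
  positivity

theorem AForm_add_left (β : ℝ) (U V W : UU Ω P) :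
    AForm β (U + V) W = AForm β U W + AForm β V W := by
  simp only [AForm, Prod.fst_add, Prod.snd_add, map_add, inner_add_left]
  ring

theorem AForm_add_right (β : ℝ) (U V W : UU Ω P) :
    AForm β U (V + W) = AForm β U V + AForm β U W := by
  rw [AForm_comm, AForm_add_left, AForm_comm β V, AForm_comm β W]

theorem AForm_smul_left (β c : ℝ) (U V : UU Ω P) : AForm β (c • U) V = c * AForm β U V := by
  simp only [AForm, Prod.smul_fst, Prod.smul_snd, map_smul, real_inner_smul_left]
  ring

theorem AForm_smul_right (β c : ℝ) (U V : UU Ω P) : AForm β U (c • V) = c * AForm β U V := by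
  rw [AForm_comm, AForm_smul_left, AForm_comm]

theorem abs_AForm_le {β : ℝ} (hβ : 0 < β) (U V : UU Ω P) :
    |AForm β U V| ≤ max 1 (2 * β) * graphNorm U * graphNorm V := by
  have h1 : |inner ℝ (RH1.toRL2 Ω P U.1) (RH1.toRL2 Ω P V.1)| ≤ ‖U.1‖ * ‖V.1‖ :=
    (abs_real_inner_le_norm _ _).trans (mul_le_mul (norm_toRL2_le _) (norm_toRL2_le _)
      (norm_nonneg _) (norm_nonneg _))
  have h2 : |inner ℝ U.2 V.2| ≤ ‖U.2‖ * ‖V.2‖ := abs_real_inner_le_norm _ _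
  calc |AForm β U V|
      ≤ |inner ℝ (RH1.toRL2 Ω P U.1) (RH1.toRL2 Ω P V.1)| + |2 * β * inner ℝ U.2 V.2| :=
        abs_add_le _ _
    _ = 1 * |inner ℝ (RH1.toRL2 Ω P U.1) (RH1.toRL2 Ω P V.1)| + 2 * β * |inner ℝ U.2 V.2| := by
        rw [abs_mul (2 * β), abs_of_pos (by positivity : 0 < 2 * β), one_mul]
    _ ≤ max 1 (2 * β) * (‖U.1‖ * ‖V.1‖) + max 1 (2 * β) * (‖U.2‖ * ‖V.2‖) := by
        gcongr
        · exact le_max_left _ _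
        · exact le_max_right _ _
    _ = max 1 (2 * β) * (‖U.1‖ * ‖V.1‖ + ‖U.2‖ * ‖V.2‖) := by ring
    _ ≤ max 1 (2 * β) * (graphNorm U * graphNorm V) := by
        refine mul_le_mul_of_nonneg_left ?_ (le_max_of_le_left zero_le_one)
        have h3 : 0 ≤ ‖U.1‖ * ‖V.2‖ := by positivity
        have h4 : 0 ≤ ‖U.2‖ * ‖V.1‖ := by positivity
        unfold graphNorm
        linarith
    _ = max 1 (2 * β) * graphNorm U * graphNorm V := by ring

namespace IsAdmissibleFamily

variable {a : FormFamily m Ω} {α₀ α₁ : ℝ} (ha : IsAdmissibleFamily P a α₀ α₁)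
include ha

theorem AForm_coercive {β : ℝ} (hβ : 0 < β) {U : UU Ω P} (hker : U ∈ kerB a)
    (hU : U ∈ UU0 Ω P) :
    2 * β * (α₀ / (1 + α₀)) ^ 2 * graphNorm U ^ 2 ≤ AForm β U U := by
  have hα := ha.coercive_pos
  have hU1 : U.1 ∈ RH10 Ω P := hU.1
  have h0 : aForm a U.1 U.1 - inner ℝ U.2 (RH1.toRL2 Ω P U.1) = 0 := hker _ hU1
  have h1 := ha.aForm_coercive hU1
  have h2 : inner ℝ U.2 (RH1.toRL2 Ω P U.1) ≤ ‖U.2‖ * ‖U.1‖ :=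
    (real_inner_le_norm _ _).trans (mul_le_mul_of_nonneg_left (norm_toRL2_le _) (norm_nonneg _))
  have h3 : α₀ * ‖U.1‖ ≤ ‖U.2‖ := by
    rcases (norm_nonneg U.1).eq_or_lt with h | h
    · rw [← h, mul_zero]
      exact norm_nonneg _
    · refine le_of_mul_le_mul_right ?_ h
      linarith
  -- Adding `α₀‖f‖` to `α₀‖u‖ ≤ ‖f‖` gives `α₀(‖u‖ + ‖f‖) ≤ (1 + α₀)‖f‖`, the source of the
  -- constant.
  have h4 : α₀ / (1 + α₀) * graphNorm U ≤ ‖U.2‖ := by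
    rw [div_mul_eq_mul_div, div_le_iff₀ (by positivity), graphNorm]
    linarith
  have h5 : (α₀ / (1 + α₀) * graphNorm U) ^ 2 ≤ ‖U.2‖ ^ 2 :=
    pow_le_pow_left₀ (mul_nonneg (by positivity) (graphNorm_nonneg U)) h4 2
  rw [AForm_self]
  calc 2 * β * (α₀ / (1 + α₀)) ^ 2 * graphNorm U ^ 2
      = 2 * β * (α₀ / (1 + α₀) * graphNorm U) ^ 2 := by ring
    _ ≤ 2 * β * ‖U.2‖ ^ 2 := by gcongr
    _ ≤ ‖RH1.toRL2 Ω P U.1‖ ^ 2 + 2 * β * ‖U.2‖ ^ 2 := le_add_of_nonneg_left (sq_nonneg _)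

theorem abs_BForm_le (U : UU Ω P) (q : RH1 Ω P) :
    |BForm a U q| ≤ max α₁ 1 * graphNorm U * ‖q‖ := by
  have h1 := ha.abs_aForm_le U.1 q
  have h2 : |inner ℝ U.2 (RH1.toRL2 Ω P q)| ≤ ‖U.2‖ * ‖q‖ :=
    (abs_real_inner_le_norm _ _).trans
      (mul_le_mul_of_nonneg_left (norm_toRL2_le _) (norm_nonneg _))
  calc |BForm a U q| ≤ |aForm a U.1 q| + |inner ℝ U.2 (RH1.toRL2 Ω P q)| := abs_sub _ _
    _ ≤ α₁ * (‖U.1‖ * ‖q‖) + 1 * (‖U.2‖ * ‖q‖) := by linarith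
    _ ≤ max α₁ 1 * (‖U.1‖ * ‖q‖) + max α₁ 1 * (‖U.2‖ * ‖q‖) := by
        gcongr
        · exact le_max_left _ _
        · exact le_max_right _ _
    _ = max α₁ 1 * graphNorm U * ‖q‖ := by
        rw [graphNorm]
        ring

theorem inf_sup {q : RH1 Ω P} (hq : q ∈ RH10 Ω P) :
    α₀ * ‖q‖ ≤ ⨆ U : {U : UU Ω P // U ≠ 0}, BForm a U.1 q / graphNorm U.1 := by
  -- An unbounded real supremum would take the default value `0`, so boundedness of the quotients
  -- has to be shown.
  have hbdd : BddAbove (Set.range fun U : {U : UU Ω P // U ≠ 0} =>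
      BForm a U.1 q / graphNorm U.1) := by
    refine ⟨max α₁ 1 * ‖q‖, ?_⟩
    rintro _ ⟨U, rfl⟩
    refine div_le_of_le_mul₀ (graphNorm_nonneg _)
      (mul_nonneg (le_max_of_le_right zero_le_one) (norm_nonneg _)) ?_
    have := (le_abs_self _).trans (ha.abs_BForm_le U.1 q)
    linarith
  rcases eq_or_ne q 0 with rfl | hq0
  · rw [norm_zero, mul_zero]
    refine Real.iSup_nonneg fun U => ?_
    have h := ha.abs_BForm_le U.1 0
    rw [norm_zero, mul_zero] at h
    rw [abs_nonpos_iff.1 h, zero_div]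
  · have hn : 0 < ‖q‖ := norm_pos_iff.2 hq0
    refine le_trans ?_ (le_ciSup hbdd ⟨(q, 0), fun h => hq0 (congrArg Prod.fst h)⟩)
    have h := ha.aForm_coercive hq
    simp only [BForm, graphNorm, inner_zero_left, sub_zero, norm_zero, add_zero]
    rw [le_div_iff₀ hn]
    linarith

theorem BForm_add_left (U V : UU Ω P) (q : RH1 Ω P) :
    BForm a (U + V) q = BForm a U q + BForm a V q := by
  simp only [BForm, Prod.fst_add, Prod.snd_add, ha.aForm_add_left, inner_add_left]
  ring

omit ha in
theorem BForm_smul_left (c : ℝ) (U : UU Ω P) (q : RH1 Ω P) :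
    BForm a (c • U) q = c * BForm a U q := by
  simp only [BForm, Prod.smul_fst, Prod.smul_snd, aForm_smul_left, real_inner_smul_left]
  ring

theorem BForm_sub_left (U V : UU Ω P) (q : RH1 Ω P) :
    BForm a (U - V) q = BForm a U q - BForm a V q := by
  have := ha.BForm_add_left (U - V) V q
  rw [sub_add_cancel] at this
  linarith

omit ha in
theorem BForm_mk_zero (w q : RH1 Ω P) : BForm a (w, 0) q = aForm a w q := by
  simp only [BForm, inner_zero_left, sub_zero]

/-- Subtracting `(w, 0)` moves `U` into the kernel of `𝓑` while leaving the control unchanged. -/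
theorem exists_BForm_eq (U : UU Ω P) :
    ∃ w ∈ RH10 Ω P, ∀ q ∈ RH10 Ω P, aForm a w q = BForm a U q :=
  ha.exists_aForm_eq (ha.toBilin U.1 - (innerSL ℝ U.2).comp (RH1.toRL2 Ω P))

/-! ### Quadratic minimization and saddle points -/

-- The exact second-order expansion: the bracket is the derivative at `U` in the direction `W`.
omit ha in
theorem quadCost_add (β : ℝ) (uhat : RL2 Ω P) (U W : UU Ω P) :
    quadCost β uhat (U + W) = quadCost β uhat U +
      (AForm β U W - inner ℝ uhat (RH1.toRL2 Ω P W.1)) + 1 / 2 * AForm β W W := by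
  simp only [quadCost, AForm_add_left, AForm_add_right, Prod.fst_add, map_add, inner_add_right]
  rw [AForm_comm β W U]
  ring

/-- First-order characterization of the minimizers of a quadratic functional over an affine set. -/
theorem isQuadMinimizer_iff {β : ℝ} (hβ : 0 < β) (uhat : RL2 Ω P) {Uad : Set (UU Ω P)}
    {V : Submodule ℝ (UU Ω P)} (hV : ∀ U ∈ Uad, ∀ W, U + W ∈ Uad ↔ W ∈ V) (U : UU Ω P) :
    IsQuadMinimizer Uad a β uhat U ↔ U ∈ Uad ∧ (∀ q ∈ RH10 Ω P, BForm a U q = 0) ∧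
      ∀ W ∈ V, (∀ q ∈ RH10 Ω P, BForm a W q = 0) →
        AForm β U W = inner ℝ uhat (RH1.toRL2 Ω P W.1) := by
  constructor
  · rintro ⟨⟨hU, hB⟩, hmin⟩
    refine ⟨hU, hB, fun W hW hWB => ?_⟩
    set D := AForm β U W - inner ℝ uhat (RH1.toRL2 Ω P W.1) with hD
    set A := AForm β W W
    have key (t : ℝ) : 0 ≤ t * D + 1 / 2 * (t ^ 2 * A) := by
      have h := hmin (U + t • W) ⟨(hV U hU _).2 (V.smul_mem t hW), fun q hq => by
        rw [ha.BForm_add_left, BForm_smul_left, hB q hq, hWB q hq, mul_zero, add_zero]⟩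
      rw [quadCost_add, AForm_smul_right, AForm_smul_left, AForm_smul_right, Prod.smul_fst,
        map_smul, real_inner_smul_right] at h
      rw [hD]
      linarith
    have hA : 0 ≤ A := AForm_self_nonneg hβ W
    -- The optimal step `-D / A` fails for `A = 0`. With `1 + A` the denominator is positive, and
    -- the change in cost is still negative unless `D = 0`.
    have h := key (-D / (1 + A))
    have h2 : -D / (1 + A) * D + 1 / 2 * ((-D / (1 + A)) ^ 2 * A) =
        -(D ^ 2 * (2 + A)) / (2 * (1 + A) ^ 2) := by
      field_simp
      ring
    rw [h2, le_div_iff₀ (by positivity), zero_mul] at h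
    have h3 : D ^ 2 * (2 + A) ≤ 0 := by linarith
    have h4 : D ^ 2 = 0 :=
      le_antisymm (nonpos_of_mul_nonpos_left h3 (by positivity)) (sq_nonneg _)
    exact sub_eq_zero.1 (pow_eq_zero_iff two_ne_zero |>.1 h4)
  · rintro ⟨hU, hB, h⟩
    refine ⟨⟨hU, hB⟩, fun W hW => ?_⟩
    have hWU : W - U ∈ V := (hV U hU _).1 (by rw [add_sub_cancel]; exact hW.1)
    have h1 := h _ hWU fun q hq => by rw [ha.BForm_sub_left, hW.2 q hq, hB q hq, sub_zero]
    -- With the derivative zero, only the nonnegative quadratic remainder separates the two costs.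
    have h2 := quadCost_add β uhat U (W - U)
    rw [add_sub_cancel, h1, sub_self, add_zero] at h2
    have h3 := AForm_self_nonneg hβ (W - U)
    linarith

/-- The hypothesis `hV0` lets `V` contain all pairs `(w, 0)` with `w ∈ 𝓗¹₀(Ω)`. These suffice to
determine the multiplier and to correct any element of `V` to a kernel element within `V`, so both
choices of boundary condition are covered. -/
theorem isQuadMinimizer_iff_existsUnique {β : ℝ} (hβ : 0 < β) (uhat : RL2 Ω P)
    {Uad : Set (UU Ω P)} {V : Submodule ℝ (UU Ω P)}
    (hV : ∀ U ∈ Uad, ∀ W, U + W ∈ Uad ↔ W ∈ V)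
    (hV0 : ∀ w ∈ RH10 Ω P, ((w, 0) : UU Ω P) ∈ V) (U : UU Ω P) :
    IsQuadMinimizer Uad a β uhat U ↔ ∃! lam : RH1 Ω P, IsSaddlePoint Uad V a β uhat U lam := by
  rw [ha.isQuadMinimizer_iff hβ uhat hV]
  constructor
  · rintro ⟨hU, hB, h⟩
    obtain ⟨lam, hlam, hl⟩ := ha.exists_aForm_flip_eq
      ((innerSL ℝ (uhat - RH1.toRL2 Ω P U.1)).comp (RH1.toRL2 Ω P))
    have hl' : ∀ w ∈ RH10 Ω P, aForm a w lam = inner ℝ uhat (RH1.toRL2 Ω P w) -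
        AForm β U (w, 0) := fun w hw => by
      rw [hl w hw]
      simp only [ContinuousLinearMap.comp_apply, innerSL_apply_apply, inner_sub_left, AForm,
        inner_zero_right, mul_zero, add_zero]
    refine ⟨lam, ⟨hU, hlam, fun W hW => ?_, hB⟩, ?_⟩
    · obtain ⟨w, hw, hwB⟩ := ha.exists_BForm_eq W
      have h1 := h (W - (w, 0)) (V.sub_mem hW (hV0 w hw)) fun q hq => by
        rw [ha.BForm_sub_left, BForm_mk_zero, hwB q hq, sub_self]
      have h2 := AForm_add_right β U (W - (w, 0)) (w, 0)
      rw [sub_add_cancel] at h2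
      -- Stationarity handles the kernel part of `W`, the adjoint equation the part `(w, 0)`.
      rw [← hwB lam hlam, hl' w hw, h2, h1, Prod.fst_sub, map_sub, inner_sub_right]
      ring
    · rintro p ⟨-, hp, hpS, -⟩
      refine ha.eq_of_aForm_eq hp hlam fun w hw => ?_
      have := hpS _ (hV0 w hw)
      rw [BForm_mk_zero] at this
      rw [hl' w hw]
      linarith
  · rintro ⟨lam, ⟨hU, hlam, hS, hB⟩, -⟩
    refine ⟨hU, hB, fun W hW hWB => ?_⟩
    rw [← hS W hW, hWB lam hlam, add_zero]

theorem isQuadMinimizer_univ_iff {β : ℝ} (hβ : 0 < β) (uhat : RL2 Ω P) (U : UU Ω P) :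
    IsQuadMinimizer Set.univ a β uhat U ↔
      ∃! lam : RH1 Ω P, IsSaddlePoint Set.univ ⊤ a β uhat U lam :=
  ha.isQuadMinimizer_iff_existsUnique hβ uhat (fun _ _ _ => by simp) (fun _ _ => Submodule.mem_top) U

-- The trace graph is a subspace, so `(u + w, g) = (u, g) + (w, 0)` lies in it exactly when `(w, 0)`
-- does.
omit ha in
theorem add_mem_dirichletSet_iff {g : L2Bdry Ω} {U : UU Ω P} (hU : U ∈ dirichletSet g)
    (W : UU Ω P) : U + W ∈ dirichletSet g ↔ W ∈ UU0 Ω P := by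
  have h : W ∈ UU0 Ω P ↔ ∀ᵐ y ∂P, W.1 y ∈ H10 Ω := ⟨fun h => h.1, fun h => ⟨h, trivial⟩⟩
  rw [h]
  change (∀ᵐ y ∂P, HasTrace Ω ((U + W).1 y) g) ↔ _
  refine Filter.eventually_congr ?_
  have hU' : ∀ᵐ y ∂P, HasTrace Ω (U.1 y) g := hU
  filter_upwards [hU', Lp.coeFn_add U.1 W.1] with y h1 h2
  rw [Prod.fst_add, h2, Pi.add_apply, mem_H10]
  unfold HasTrace at h1 ⊢
  rw [← (traceGraph Ω).add_mem_iff_right h1 (y := (W.1 y, 0)), Prod.mk_add_mk, add_zero]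

theorem isQuadMinimizer_dirichlet_iff {β : ℝ} (hβ : 0 < β) (uhat : RL2 Ω P) (g : L2Bdry Ω)
    (U : UU Ω P) : IsQuadMinimizer (dirichletSet g) a β uhat U ↔
      ∃! lam : RH1 Ω P, IsSaddlePoint (dirichletSet g) (UU0 Ω P) a β uhat U lam :=
  ha.isQuadMinimizer_iff_existsUnique hβ uhat (fun _ hU W => add_mem_dirichletSet_iff hU W)
    (fun _ hw => ⟨hw, trivial⟩) U

/-! ### The original control problem and its optimality system -/

omit ha in
theorem cost_eq (β : ℝ) (uhat : RL2 Ω P) (U : UU Ω P) :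
    cost β uhat U = quadCost β uhat U + 1 / 2 * ‖uhat‖ ^ 2 := by
  rw [cost, quadCost, AForm_self, norm_sub_sq_real, real_inner_comm]
  ring

omit ha in
theorem isOptimalControl_iff (β : ℝ) (uhat : RL2 Ω P) (g : L2Bdry Ω) (U : UU Ω P) :
    IsOptimalControl a β uhat g U ↔ IsQuadMinimizer (dirichletSet g) a β uhat U := by
  simp only [IsOptimalControl, IsQuadMinimizer, BForm, sub_eq_zero, cost_eq,
    add_le_add_iff_right]

/-- Test pairs `(v, 0)` give the adjoint equation and `(0, h)` the gradient equation; their sum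
recovers the saddle-point equation. -/
theorem isOptimalitySystemSol_iff (β : ℝ) (uhat : RL2 Ω P) (g : L2Bdry Ω) (U : UU Ω P)
    (lam : RH1 Ω P) : IsOptimalitySystemSol a β uhat g U lam ↔
      IsSaddlePoint (dirichletSet g) (UU0 Ω P) a β uhat U lam := by
  constructor
  · rintro ⟨hU, hlam, hs, had, hg⟩
    refine ⟨hU, hlam, fun W hW => ?_, fun q hq => sub_eq_zero.2 (hs q hq)⟩
    have h1 := had W.1 hW.1
    have h2 := hg W.2
    rw [inner_sub_left] at h1
    rw [AForm, BForm]
    linarith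
  · rintro ⟨hU, hlam, hS, hB⟩
    refine ⟨hU, hlam, fun q hq => sub_eq_zero.1 (hB q hq), fun v hv => ?_, fun h => ?_⟩
    · have := hS (v, 0) ⟨hv, trivial⟩
      rw [BForm_mk_zero] at this
      simp only [AForm, inner_zero_right, mul_zero, add_zero] at this
      rw [inner_sub_left]
      linarith
    · have := hS (0, h) ⟨(RH10 Ω P).zero_mem, trivial⟩
      have h0 : aForm a 0 lam = 0 := by
        rw [← ha.toBilin_apply, map_zero, zero_apply]
      simp only [AForm, BForm, map_zero, inner_zero_right, zero_add, h0, zero_sub] at this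
      linarith

theorem isOptimalControl_iff_existsUnique {β : ℝ} (hβ : 0 < β) (uhat : RL2 Ω P)
    (g : L2Bdry Ω) (U : UU Ω P) : IsOptimalControl a β uhat g U ↔
      ∃! lam : RH1 Ω P, IsOptimalitySystemSol a β uhat g U lam := by
  simp only [isOptimalControl_iff, ha.isQuadMinimizer_dirichlet_iff hβ,
    ha.isOptimalitySystemSol_iff]

end IsAdmissibleFamily

end Fields

/-- This turns bounds valid on `Γ` into bounds valid almost everywhere for `ρ dμ`. -/
theorem ae_paramMeasure_mem {m : ℕ} {Γ : Set (E m)} (hΓ : MeasurableSet Γ)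
    (ρ : E m → ℝ≥0∞) : ∀ᵐ y ∂paramMeasure Γ ρ, y ∈ Γ :=
  (withDensity_absolutelyContinuous _ _).ae_le (ae_restrict_mem hΓ)

end StochOC

theorem mainTheorem2 {d m : ℕ} (hd : 1 ≤ d)
    (Ω : Set (StochOC.E d)) (hΩ : StochOC.IsConvexPolygonalDomain Ω)
    -- the random vector `X : D → Γ ⊆ ℝᵐ` and its joint density `ρ`
    {D : Type*} [MeasurableSpace D] (Pr : Measure D) [IsProbabilityMeasure Pr] [Pr.IsComplete]
    (Γ : Set (StochOC.E m)) (hΓ : MeasurableSet Γ)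
    (X : D → StochOC.E m) (hX : Measurable X) (hXΓ : ∀ s, X s ∈ Γ)
    (ρ : StochOC.E m → ℝ≥0∞) (hρ : Measurable ρ) (hlaw : Pr.map X = volume.withDensity ρ)
    (P : Measure (StochOC.E m)) (hP : P = StochOC.paramMeasure Γ ρ)
    -- the bilinear forms `a(·,·;μ)`
    (a : StochOC.FormFamily m Ω)
    (ha_meas : ∀ u v : StochOC.H1 Ω, AEMeasurable (fun y => a y u v) P)
    (α₀ α₁ : ℝ) (hα₀ : 0 < α₀) (hα₁ : 0 < α₁)
    (ha_coer : ∀ y ∈ Γ, ∀ v ∈ StochOC.H10 Ω, α₀ * ‖v‖ ^ 2 ≤ a y v v)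
    (ha_bdd : ∀ y ∈ Γ, ∀ u v : StochOC.H1 Ω, a y u v ≤ α₁ * ‖u‖ * ‖v‖)
    (β : ℝ) (hβ : 0 < β) (uhat : StochOC.RL2 Ω P) (g : StochOC.L2Bdry Ω) :
    -- `𝓐` is symmetric, nonnegative and continuous on `𝓤`
    ((∀ U V : StochOC.UU Ω P, StochOC.AForm β U V = StochOC.AForm β V U) ∧
      (∀ U : StochOC.UU Ω P, 0 ≤ StochOC.AForm β U U) ∧
      (∀ U V : StochOC.UU Ω P, |StochOC.AForm β U V| ≤
        max 1 (2 * β) * StochOC.graphNorm U * StochOC.graphNorm V)) ∧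
    -- `𝓐` is coercive on the kernel of `𝓑`
    (∀ U : StochOC.UU Ω P, U ∈ StochOC.kerB a → U ∈ StochOC.UU0 Ω P →
      2 * β * (α₀ / (1 + α₀)) ^ 2 * StochOC.graphNorm U ^ 2 ≤ StochOC.AForm β U U) ∧
    -- `𝓑` is well defined, continuous and satisfies the inf-sup condition
    ((∀ u v : StochOC.RH1 Ω P, Integrable (fun y => a y (u y) (v y)) P) ∧
      (∀ (U : StochOC.UU Ω P) (q : StochOC.RH1 Ω P),
        |StochOC.BForm a U q| ≤ max α₁ 1 * StochOC.graphNorm U * ‖q‖) ∧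
      (∀ q ∈ StochOC.RH10 Ω P, α₀ * ‖q‖ ≤
        ⨆ U : {U : StochOC.UU Ω P // U ≠ 0},
          StochOC.BForm a U.1 q / StochOC.graphNorm U.1)) ∧
    -- quadratic minimization and saddle-point formulation, on all of `𝓤`
    (∀ U : StochOC.UU Ω P, StochOC.IsQuadMinimizer Set.univ a β uhat U ↔
      ∃! lam : StochOC.RH1 Ω P, StochOC.IsSaddlePoint Set.univ ⊤ a β uhat U lam) ∧
    -- quadratic minimization and saddle-point formulation, with the Dirichlet condition
    (∀ U : StochOC.UU Ω P, StochOC.IsQuadMinimizer (StochOC.dirichletSet g) a β uhat U ↔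
      ∃! lam : StochOC.RH1 Ω P,
        StochOC.IsSaddlePoint (StochOC.dirichletSet g) (StochOC.UU0 Ω P) a β uhat U lam) ∧
    -- original control problem and optimality system
    (∀ U : StochOC.UU Ω P, StochOC.IsOptimalControl a β uhat g U ↔
      ∃! lam : StochOC.RH1 Ω P, StochOC.IsOptimalitySystemSol a β uhat g U lam) := by
  subst hP
  have hmem := StochOC.ae_paramMeasure_mem hΓ ρ
  have ha : StochOC.IsAdmissibleFamily (StochOC.paramMeasure Γ ρ) a α₀ α₁ :=
    { aemeasurable := ha_meas
      coercive := hmem.mono ha_coer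
      bounded := hmem.mono ha_bdd
      coercive_pos := hα₀
      bounded_pos := hα₁ }
  exact ⟨⟨StochOC.AForm_comm β, StochOC.AForm_self_nonneg hβ, StochOC.abs_AForm_le hβ⟩,
    fun U hker hU => ha.AForm_coercive hβ hker hU,
    ⟨ha.integrable, ha.abs_BForm_le, fun q hq => ha.inf_sup hq⟩,
    ha.isQuadMinimizer_univ_iff hβ uhat,
    ha.isQuadMinimizer_dirichlet_iff hβ uhat g,
    ha.isOptimalControl_iff_existsUnique hβ uhat g⟩
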